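/- For a finite simple graph $H$ with $v$ vertices and $e(H)$ edges, let $M(H;n)$ be the minimum, over all $2$-edge-colourings of the complete graph $K_n$, of the number of monochromatic labelled copies of $H$ (a labelled copy being an injective map from $V(H)$ to $V(K_n)$ that sends all edges of $H$ to edges of one and the same colour), and let $$C(H)=\lim_{n\to\infty}\frac{M(H;n)}{n(n-1)\cdots(n-v+1)}.$$ The graph $H$ is called common if $C(H)=2^{1-e(H)}$. For $m\ge 3$, the $m$-wheel is the graph obtained from the cycle $C_m$ (its rim) by adding one new vertex adjacent to all vertices of $C_m$, and the $m$-beachball $B_m$ is the graph obtained by gluing two copies of the $m$-wheel along their rims; that is, $B_m$ consists of the cycle $C_m$ and two further non-adjacent vertices, each adjacent to all vertices of $C_m$. Theorem. For every integer $k\ge 2$, the $2k$-beachball $B_{2k}$ is common. -/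

import Mathlib

open Filter Topology

namespace CommonGraph

/-- The Ramsey multiplicity `M(H; n)`: the minimum number of monochromatic labelled copies of `H`
over all 2-edge-colourings of `K_n`. A colouring is given by the graph `G` of its red edges, so the
blue edges form the complement `Gᶜ`; a labelled copy is an injective homomorphism. The infimum is
over a nonempty set of natural numbers, hence is a minimum. -/
noncomputable def ramseyMultiplicity {V : Type*} [Fintype V] (H : SimpleGraph V) (n : ℕ) : ℕ :=
  ⨅ G : SimpleGraph (Fin n), (G.labelledCopyCount H + Gᶜ.labelledCopyCount H)

/-- The graph `H` has Ramsey multiplicity constant `C`: with `v` the number of vertices of `H`,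
`M(H; n) / (n (n - 1) ⋯ (n - v + 1))` tends to `C` as `n → ∞`. -/
def HasRamseyMultiplicityConstant {V : Type*} [Fintype V] (H : SimpleGraph V) (C : ℝ) : Prop :=
  Tendsto (fun n : ℕ => (ramseyMultiplicity H n : ℝ) / (n.descFactorial (Fintype.card V) : ℝ))
    atTop (𝓝 C)

/-- `H` is common if its Ramsey multiplicity constant is `2 ^ (1 - e(H))`. -/
def IsCommon {V : Type*} [Fintype V] (H : SimpleGraph V) : Prop :=
  HasRamseyMultiplicityConstant H ((2 : ℝ) ^ (1 - (Nat.card H.edgeSet : ℤ)))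

/-- The `k`-wheel: the cycle `C_k` (the rim) together with one further vertex (the hub) that is
adjacent to every vertex of the cycle. -/
def wheel (k : ℕ) : SimpleGraph (Fin k ⊕ Unit) :=
  (SimpleGraph.cycleGraph k ⊕g (⊥ : SimpleGraph Unit)) ⊔ completeBipartiteGraph (Fin k) Unit

/-- The placement of the `b`-th copy of the wheel in the glued graph: the rim vertices are shared by
the two copies, and the hub becomes the hub with index `b`. -/
def place (k : ℕ) (b : Bool) : Fin k ⊕ Unit ↪ Fin k ⊕ Bool where
  toFun := Sum.map id (fun _ => b)
  inj' := by
    rintro (x | x) (y | y) h <;> simp_all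

@[simp] theorem place_inl {k : ℕ} (b : Bool) (i : Fin k) : place k b (.inl i) = .inl i := rfl

@[simp] theorem place_inr {k : ℕ} (b : Bool) (u : Unit) : place k b (.inr u) = .inr b := rfl

/-- The `k`-beachball: two copies of the `k`-wheel glued along their rim `k`-cycles. -/
def beachball (k : ℕ) : SimpleGraph (Fin k ⊕ Bool) :=
  (wheel k).map (place k false) ⊔ (wheel k).map (place k true)

theorem beachball_adj_inl_inl {k : ℕ} (i j : Fin k) :
    (beachball k).Adj (.inl i) (.inl j) ↔ (SimpleGraph.cycleGraph k).Adj i j := by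
  simp [beachball, wheel]

theorem beachball_adj_inl_inr {k : ℕ} (i : Fin k) (b : Bool) :
    (beachball k).Adj (.inl i) (.inr b) := by
  cases b <;> simp [beachball, wheel]

theorem not_beachball_adj_inr_inr {k : ℕ} (a b : Bool) :
    ¬ (beachball k).Adj (.inr a) (.inr b) := by
  simp [beachball, wheel]

end CommonGraph

/-!
The upper bound is the first-moment argument: a uniformly random colouring contains each injective
placement of a graph with `e` edges monochromatically with probability `2 ^ (1 - e)`.

For the lower bound, let `W` be the 0/1 matrix of the red graph on `n` vertices and let `1 - W` be
that of the blue graph with loops added; loops matter only for non-injective maps, which are a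
vanishing proportion. Fixing the two hubs `u`, `v` of a beachball, its rims are the closed walks of
length `2k` in the common neighbourhood of `u` and `v`. If that neighbourhood has `D` vertices and
`K` ordered adjacent pairs, there are at least `(K / D) ^ (2k)` such walks, since the trace of
an even power of a symmetric matrix dominates the power of any Rayleigh quotient
(`rayleigh_pow_le_trace`). Since `k ≥ 2`, a Bernoulli inequality in `(8 K / (D n)) ^ 2` followed by
AM-GM bounds the rescaled number of walks below by a linear function of
`128 K - 8 n D - 16 D ^ 2` (`le_trace_linkMatrix_pow`).

Summed over `u` and `v`, the three terms count diamonds, cherries and four-cycles, so it remains to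
show that these quantities for `W` and `1 - W` add up to at least `2 n ^ 4`
(`two_mul_card_pow_le_sum`). Writing `W = 1/2 + U`, with `r` the row sums of `U`, the `(x, y)`
term is `2 n² + 32 n P + 96 P² + 24 S² + 64 n U S + 256 U S P`, where `P` is the `(x, y)` entry of
the square of `U` and `S = r x + r y`. As `U² = 1/4` entrywise, the terms quadratic in `P` and `S`
are at least `-(56/3) S²`, and this loss is absorbed because `P` and `U S` sum to positive multiples
of `∑ r²`.
-/

namespace CommonGraph

open Finset Matrix

/-! ### Closed walks and the diamond inequality -/

section Analytic

variable {V : Type*} [Fintype V]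

theorem dotProduct_pow_add_mulVec [DecidableEq V] {A : Matrix V V ℝ} (hA : A.IsSymm)
    (g : V → ℝ) (i j : ℕ) :
    g ⬝ᵥ (A ^ (i + j)) *ᵥ g = ((A ^ i) *ᵥ g) ⬝ᵥ ((A ^ j) *ᵥ g) := by
  rw [pow_add, ← mulVec_mulVec, dotProduct_mulVec, ← mulVec_transpose, (hA.pow i).eq]

theorem dotProduct_sq_le (a b : V → ℝ) : (a ⬝ᵥ b) ^ 2 ≤ (a ⬝ᵥ a) * (b ⬝ᵥ b) := by
  simpa [dotProduct, sq] using sum_mul_sq_le_sq_mul_sq univ a b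

theorem trace_pow_two_mul_nonneg [DecidableEq V] {A : Matrix V V ℝ} (hA : A.IsSymm) (k : ℕ) :
    0 ≤ (A ^ (2 * k)).trace := by
  rw [two_mul, pow_add]
  nth_rw 1 [← (hA.pow k).eq]
  simp only [trace, diag_apply, mul_apply, transpose_apply]
  exact sum_nonneg fun _ _ => sum_nonneg fun _ _ => mul_self_nonneg _

theorem dotProduct_pow_mulVec_le_trace [DecidableEq V] {A : Matrix V V ℝ} (hA : A.IsSymm)
    (g : V → ℝ) (k : ℕ) :
    g ⬝ᵥ (A ^ (2 * k)) *ᵥ g ≤ (g ⬝ᵥ g) * (A ^ (2 * k)).trace := by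
  rw [two_mul, dotProduct_pow_add_mulVec hA, pow_add]
  nth_rw 3 [← (hA.pow k).eq]
  simp only [trace, diag_apply, mul_apply, transpose_apply]
  rw [sum_comm, mul_sum]
  refine sum_le_sum fun x _ => ?_
  have h := dotProduct_sq_le (fun y => (A ^ k) x y) g
  rw [mul_comm, sq] at h
  exact h

/-- The moments `g ⬝ᵥ A ^ j *ᵥ g` are log-convex along even `j`, so their ratios never drop below
the first one, which Cauchy-Schwarz bounds below by the squared Rayleigh quotient. -/
theorem rayleigh_sq_mul_le [DecidableEq V] {A : Matrix V V ℝ} (hA : A.IsSymm) {g : V → ℝ}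
    (hg : 0 < g ⬝ᵥ g) (h1 : g ⬝ᵥ A *ᵥ g ≠ 0) (k : ℕ) :
    0 < g ⬝ᵥ (A ^ (2 * k)) *ᵥ g ∧
    ((g ⬝ᵥ A *ᵥ g) / (g ⬝ᵥ g)) ^ 2 * (g ⬝ᵥ (A ^ (2 * k)) *ᵥ g) ≤
      g ⬝ᵥ (A ^ (2 * (k + 1))) *ᵥ g := by
  have cs : ∀ i j, (g ⬝ᵥ (A ^ (i + j)) *ᵥ g) ^ 2 ≤
      (g ⬝ᵥ (A ^ (2 * i)) *ᵥ g) * (g ⬝ᵥ (A ^ (2 * j)) *ᵥ g) := fun i j => by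
    rw [dotProduct_pow_add_mulVec hA, two_mul, two_mul, dotProduct_pow_add_mulVec hA,
      dotProduct_pow_add_mulVec hA]
    exact dotProduct_sq_le _ _
  have hc : 0 < ((g ⬝ᵥ A *ᵥ g) / (g ⬝ᵥ g)) ^ 2 := by positivity
  induction k with
  | zero =>
    have h := cs 0 1
    simp only [zero_add, pow_one, mul_zero, pow_zero, one_mulVec, mul_one] at h ⊢
    refine ⟨hg, ?_⟩
    rw [div_pow, div_mul_eq_mul_div, div_le_iff₀ (by positivity)]
    nlinarith
  | succ k ih =>
    obtain ⟨h0, h2⟩ := ih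
    have h := cs k (k + 2)
    rw [show k + (k + 2) = 2 * (k + 1) by ring] at h
    have hpos := lt_of_lt_of_le (mul_pos hc h0) h2
    refine ⟨hpos, ?_⟩
    refine le_of_mul_le_mul_left ?_ h0
    refine le_trans ?_ h
    rw [sq (g ⬝ᵥ (A ^ (2 * (k + 1))) *ᵥ g), ← mul_assoc, mul_comm _ (_ ^ 2)]
    exact mul_le_mul_of_nonneg_right h2 hpos.le

/-- The trace of an even power of a symmetric matrix dominates the same power of any Rayleigh
quotient. For `g = 0` the quotient is `0 / 0 = 0`. -/
theorem rayleigh_pow_le_trace [DecidableEq V] {A : Matrix V V ℝ} (hA : A.IsSymm)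
    (g : V → ℝ) {k : ℕ} (hk : k ≠ 0) :
    ((g ⬝ᵥ A *ᵥ g) / (g ⬝ᵥ g)) ^ (2 * k) ≤ (A ^ (2 * k)).trace := by
  have hgn : 0 ≤ g ⬝ᵥ g := sum_nonneg fun _ _ => mul_self_nonneg _
  rcases eq_or_ne ((g ⬝ᵥ A *ᵥ g) / (g ⬝ᵥ g)) 0 with h | h
  · rw [h, zero_pow (by omega)]
    exact trace_pow_two_mul_nonneg hA k
  · have h1 : g ⬝ᵥ A *ᵥ g ≠ 0 := fun h0 => h (by rw [h0, zero_div])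
    have hg : 0 < g ⬝ᵥ g := lt_of_le_of_ne hgn fun h0 => h (by rw [← h0, div_zero])
    have key : ∀ j, ((g ⬝ᵥ A *ᵥ g) / (g ⬝ᵥ g)) ^ (2 * j) * (g ⬝ᵥ g) ≤
        g ⬝ᵥ (A ^ (2 * j)) *ᵥ g := by
      intro j
      induction j with
      | zero => simp
      | succ j ih =>
        refine le_trans ?_ (rayleigh_sq_mul_le hA hg h1 j).2
        rw [mul_add, mul_one, pow_add, mul_comm (_ ^ (2 * j)), mul_assoc]
        exact mul_le_mul_of_nonneg_left ih (sq_nonneg _)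
    refine le_of_mul_le_mul_right ?_ hg
    rw [mul_comm (trace _)]
    exact (key k).trans (dotProduct_pow_mulVec_le_trace hA g k)

/-- A quadratic form of Bernoulli's inequality. -/
theorem one_add_half_mul_le_pow {y : ℝ} (hy : 0 ≤ y) {k : ℕ} (hk : 2 ≤ k) :
    1 + (k : ℝ) / 2 * (y ^ 2 - 1) ≤ y ^ k := by
  induction k, hk using Nat.le_induction with
  | base => norm_num
  | succ k hk ih =>
    have hk' : (2 : ℝ) ≤ k := by exact_mod_cast hk
    have h : 0 ≤ (y - 1) ^ 2 * (k * y + (k - 1)) :=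
      mul_nonneg (sq_nonneg _) (by nlinarith [mul_nonneg (by linarith : (0 : ℝ) ≤ k) hy])
    have h' := mul_le_mul_of_nonneg_right ih hy
    rw [pow_succ y k]
    push_cast
    nlinarith

/-- The adjacency matrix of the common neighbourhood of `u` and `v`, extended by zero. -/
def linkMatrix (W : Matrix V V ℝ) (u v : V) : Matrix V V ℝ :=
  fun x y => W u x * W v x * W x y * (W u y * W v y)

/-- The common neighbourhood counts of pairs of vertices. -/
def codegree (W : Matrix V V ℝ) (x y : V) : ℝ := ∑ u, W u x * W u y

omit [Fintype V] in
theorem linkMatrix_isSymm {W : Matrix V V ℝ} (hW : W.IsSymm) (u v : V) :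
    (linkMatrix W u v).IsSymm := by
  ext x y
  simp only [transpose_apply, linkMatrix, hW.apply x y]
  ring

/-- Lower bound for the weighted number of closed walks in a common neighbourhood, linear in the
number `K` of ordered adjacent pairs it contains. With `D` the size of the neighbourhood, the
Rayleigh bound gives the closed walks in terms of `X = 8 K / (D n)`, and AM-GM gives
`128 K / n ^ 2 ≤ X ^ 4 + 8 D / n + 16 D ^ 2 / n ^ 2`, with equality at `K = n ^ 2 / 32`,
`D = n / 4`, the values in a random graph. -/
theorem le_trace_linkMatrix_pow [DecidableEq V] [Nonempty V] {W : Matrix V V ℝ} (hW : W.IsSymm)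
    (h01 : ∀ x y, W x y = 0 ∨ W x y = 1) {k : ℕ} (hk : 2 ≤ k) (u v : V) :
    1 + (k : ℝ) / 2 * ((128 * (∑ x, ∑ y, linkMatrix W u v x y)
        - 8 * Fintype.card V * codegree W u v - 16 * codegree W u v ^ 2) / Fintype.card V ^ 2 - 1) ≤
      (8 / Fintype.card V) ^ (2 * k) * (linkMatrix W u v ^ (2 * k)).trace := by
  set n : ℝ := (Fintype.card V : ℝ) with hn
  have hn0 : 0 < n := by rw [hn]; exact_mod_cast Fintype.card_pos
  set g : V → ℝ := fun x => W u x * W v x with hg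
  have hsq : ∀ x y, W x y * W x y = W x y := fun x y => by rcases h01 x y with h | h <;> simp [h]
  have h0 : ∀ x y, 0 ≤ W x y := fun x y => by rcases h01 x y with h | h <;> simp [h]
  have hgg : g ⬝ᵥ g = codegree W u v := by
    simp only [dotProduct, hg, codegree]
    refine sum_congr rfl fun x _ => ?_
    rw [mul_mul_mul_comm, hsq, hsq, hW.apply x u, hW.apply x v]
  have hgAg : g ⬝ᵥ linkMatrix W u v *ᵥ g = ∑ x, ∑ y, linkMatrix W u v x y := by
    simp only [dotProduct, mulVec, mul_sum]
    refine sum_congr rfl fun x _ => sum_congr rfl fun y _ => ?_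
    simp only [hg, linkMatrix]
    linear_combination (W v x ^ 2 * W x y * W u y ^ 2 * W v y ^ 2) * hsq u x
      + (W u x * W x y * W u y ^ 2 * W v y ^ 2) * hsq v x
      + (W u x * W v x * W x y * W v y ^ 2) * hsq u y
      + (W u x * W v x * W x y * W u y) * hsq v y
  have hR := rayleigh_pow_le_trace (linkMatrix_isSymm hW u v) g (k := k) (by omega)
  rw [hgg, hgAg] at hR
  set K := ∑ x, ∑ y, linkMatrix W u v x y with hK
  set D := codegree W u v with hD
  have hD0 : 0 ≤ D := sum_nonneg fun x _ => mul_nonneg (h0 _ _) (h0 _ _)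
  have hK0 : 0 ≤ K := sum_nonneg fun x _ => sum_nonneg fun y _ => by
    exact mul_nonneg (mul_nonneg (mul_nonneg (h0 _ _) (h0 _ _)) (h0 _ _))
      (mul_nonneg (h0 _ _) (h0 _ _))
  -- An empty common neighbourhood spans no edges, so the junk quotient `K / 0 = 0` is harmless.
  have hDK : D = 0 → K = 0 := fun hD0 => by
    have hg0 : g = 0 := dotProduct_self_eq_zero.1 (by rw [hgg, hD0])
    rw [← hgAg, hg0, zero_dotProduct]
  set X := 8 / n * (K / D) with hX
  have hXD : X * (4 * D / n) = 32 * K / n ^ 2 := by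
    rcases eq_or_ne D 0 with h | h
    · simp [h, hDK h]
    · rw [hX]; field_simp; ring
  have hX0 : 0 ≤ X := by positivity
  have amgm : 4 * (X * (4 * D / n)) ≤ X ^ 4 + 2 * (4 * D / n) + (4 * D / n) ^ 2 := by
    have ht : 0 ≤ 4 * D / n := by positivity
    nlinarith [sq_nonneg (4 * D / n - X ^ 2), mul_nonneg ht (sq_nonneg (X - 1))]
  rw [hXD] at amgm
  have e : (128 * K - 8 * n * D - 16 * D ^ 2) / n ^ 2 =
      4 * (32 * K / n ^ 2) - 2 * (4 * D / n) - (4 * D / n) ^ 2 := by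
    field_simp; ring
  calc _ ≤ 1 + (k : ℝ) / 2 * ((X ^ 2) ^ 2 - 1) := by
        rw [e]
        have : 4 * (32 * K / n ^ 2) - 2 * (4 * D / n) - (4 * D / n) ^ 2 ≤ (X ^ 2) ^ 2 := by
          nlinarith
        gcongr
    _ ≤ (X ^ 2) ^ k := one_add_half_mul_le_pow (sq_nonneg X) hk
    _ = (8 / n) ^ (2 * k) * (K / D) ^ (2 * k) := by rw [← pow_mul, hX, mul_pow]
    _ ≤ _ := by gcongr

/-- Both sides count the diamonds `K₄⁻`, from the nonadjacent pair and from its central edge. -/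
theorem sum_linkMatrix (W : Matrix V V ℝ) :
    ∑ u, ∑ v, ∑ x, ∑ y, linkMatrix W u v x y = ∑ x, ∑ y, W x y * codegree W x y ^ 2 := by
  have : ∀ u, ∑ v, ∑ x, ∑ y, linkMatrix W u v x y = ∑ x, ∑ y, ∑ v, linkMatrix W u v x y := by
    intro u
    rw [sum_comm]
    exact sum_congr rfl fun x _ => sum_comm
  simp_rw [this]
  rw [sum_comm]
  refine sum_congr rfl fun x _ => ?_
  rw [sum_comm]
  refine sum_congr rfl fun y _ => ?_
  simp only [codegree, sq, sum_mul_sum]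
  simp only [mul_sum, linkMatrix]
  exact sum_congr rfl fun _ _ => sum_congr rfl fun _ _ => by ring

/-- Writing `W = 1/2 + U`, every term is `2 n ^ 2` plus a nonnegative quadratic form plus terms whose
total is at least a nonnegative multiple of the sum of the squared row sums of `U`. -/
theorem two_mul_card_pow_le_sum {W : Matrix V V ℝ} (hW : W.IsSymm)
    (h01 : ∀ x y, W x y = 0 ∨ W x y = 1) :
    2 * (Fintype.card V : ℝ) ^ 4 ≤ ∑ x, ∑ y,
      ((128 * (W x y * codegree W x y ^ 2) - 8 * Fintype.card V * codegree W x y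
          - 16 * codegree W x y ^ 2)
        + (128 * ((1 - W x y) * codegree (fun a b => 1 - W a b) x y ^ 2)
          - 8 * Fintype.card V * codegree (fun a b => 1 - W a b) x y
          - 16 * codegree (fun a b => 1 - W a b) x y ^ 2)) := by
  set n : ℝ := (Fintype.card V : ℝ) with hn
  have hn0 : 0 ≤ n := by positivity
  set U : V → V → ℝ := fun x y => W x y - 1 / 2 with hU
  have hUs : ∀ x y, U x y = U y x := fun x y => by simp only [hU, hW.apply y x]
  have hU2 : ∀ x y, U x y ^ 2 = 1 / 4 := fun x y => by
    rcases h01 x y with h | h <;> simp [hU, h] <;> norm_num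
  set r : V → ℝ := fun x => ∑ u, U u x with hr
  set P : V → V → ℝ := fun x y => ∑ u, U u x * U u y with hP
  have hc : ∀ x y, codegree W x y = n / 4 + (r x + r y) / 2 + P x y := fun x y => by
    have : ∀ u, W u x * W u y = 1 / 4 + (U u x / 2 + U u y / 2) + U u x * U u y := fun u => by
      simp only [hU]; ring
    simp only [codegree, this, sum_add_distrib, ← sum_div, hr, hP, hn, sum_const, card_univ,
      nsmul_eq_mul]
    ring
  have hc' : ∀ x y, codegree (fun a b => 1 - W a b) x y = n / 4 - (r x + r y) / 2 + P x y :=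
    fun x y => by
    have : ∀ u, (1 - W u x) * (1 - W u y) = 1 / 4 - (U u x / 2 + U u y / 2) + U u x * U u y :=
      fun u => by simp only [hU]; ring
    simp only [codegree, this, sum_add_distrib, sum_sub_distrib, ← sum_div, hr, hP, hn, sum_const,
      card_univ, nsmul_eq_mul]
    ring
  set R := ∑ x, r x ^ 2 with hR
  have hR0 : 0 ≤ R := sum_nonneg fun _ _ => sq_nonneg _
  have hPsum : ∑ x, ∑ y, P x y = R := by
    have : ∀ u, r u = ∑ x, U u x := fun u => sum_congr rfl fun x _ => hUs x u
    simp only [hP, hR, this, sq, sum_mul_sum]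
    trans ∑ x, ∑ u, ∑ y, U u x * U u y
    · exact sum_congr rfl fun x _ => sum_comm
    · rw [sum_comm]
  have hrx : ∑ x, ∑ _y : V, r x ^ 2 = n * R := by
    simp only [sum_const, card_univ, nsmul_eq_mul, ← mul_sum, hR, hn]
  have hry : ∑ x : V, ∑ y, r y ^ 2 = n * R := by
    simp only [sum_const, card_univ, nsmul_eq_mul, hR, hn]
  have hUy : ∑ x, ∑ y, U x y * r y = R := by
    rw [sum_comm]
    simp only [← sum_mul, hR, sq, hr]
  have hUx : ∑ x, ∑ y, U x y * r x = R := by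
    simp only [← sum_mul, hR, sq]
    refine sum_congr rfl fun x _ => ?_
    congr 1
    exact sum_congr rfl fun y _ => hUs x y
  have hconst : ∑ _x : V, ∑ _y : V, (2 * n ^ 2) = 2 * n ^ 4 := by
    simp only [sum_const, card_univ, nsmul_eq_mul, ← hn]; ring
  calc 2 * n ^ 4 ≤ 2 * n ^ 4 + 32 * n * R + 64 * n * (R + R) - 112 / 3 * (n * R + n * R) := by
        nlinarith [mul_nonneg hn0 hR0]
    _ = ∑ x, ∑ y, (2 * n ^ 2 + 32 * n * P x y + 64 * n * (U x y * r x + U x y * r y)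
          - 112 / 3 * (r x ^ 2 + r y ^ 2)) := by
        simp only [sum_add_distrib, sum_sub_distrib, ← mul_sum, hPsum, hrx, hry, hUx, hUy]
        rw [← hconst]; simp only [mul_sum]
    _ ≤ _ := by
        refine sum_le_sum fun x _ => sum_le_sum fun y _ => ?_
        rw [hc, hc', show W x y = 1 / 2 + U x y by simp [hU]]
        -- The slack is `96 (P + 4/3 U S) ^ 2` with `S = r x + r y`, using `U ^ 2 = 1/4`.
        have h1 := sq_nonneg (P x y + 4 / 3 * U x y * (r x + r y))
        have h2 : (P x y + 4 / 3 * U x y * (r x + r y)) ^ 2 = P x y ^ 2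
            + 8 / 3 * (U x y * (r x + r y) * P x y) + 4 / 9 * (r x + r y) ^ 2 := by
          linear_combination (16 / 9 * (r x + r y) ^ 2) * hU2 x y
        rw [h2] at h1
        nlinarith [sq_nonneg (r x - r y)]

/-- The lower bound in terms of matrices: the traces sum to the homomorphism counts of the
beachball into the two colour classes. -/
theorem le_sum_trace_linkMatrix [DecidableEq V] [Nonempty V] {W : Matrix V V ℝ} (hW : W.IsSymm)
    (h01 : ∀ x y, W x y = 0 ∨ W x y = 1) {k : ℕ} (hk : 2 ≤ k) :
    2 * (Fintype.card V : ℝ) ^ 2 ≤ (8 / Fintype.card V) ^ (2 * k) *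
      ((∑ u, ∑ v, (linkMatrix W u v ^ (2 * k)).trace) +
        ∑ u, ∑ v, (linkMatrix (fun a b => 1 - W a b) u v ^ (2 * k)).trace) := by
  set W' : Matrix V V ℝ := fun a b => 1 - W a b with hW'
  have hWs' : W'.IsSymm := by
    ext x y
    change 1 - W y x = 1 - W x y
    rw [hW.apply]
  have h01' : ∀ x y, W' x y = 0 ∨ W' x y = 1 := fun x y => by
    rcases h01 x y with h | h <;> simp [hW', h]
  set n : ℝ := (Fintype.card V : ℝ) with hn
  have hn0 : 0 < n := by rw [hn]; exact_mod_cast Fintype.card_pos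
  have key : ∀ Z : Matrix V V ℝ, Z.IsSymm → (∀ x y, Z x y = 0 ∨ Z x y = 1) →
      n ^ 2 + (k : ℝ) / 2 * ((∑ x, ∑ y, (128 * (Z x y * codegree Z x y ^ 2)
        - 8 * n * codegree Z x y - 16 * codegree Z x y ^ 2)) / n ^ 2 - n ^ 2) ≤
      (8 / n) ^ (2 * k) * ∑ u, ∑ v, (linkMatrix Z u v ^ (2 * k)).trace := fun Z hZ hZ1 => by
    have h := sum_le_sum fun u (_ : u ∈ univ) => sum_le_sum fun v (_ : v ∈ univ) =>
      le_trace_linkMatrix_pow hZ hZ1 hk u v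
    simp only [← mul_sum, ← hn] at h
    refine le_trans (le_of_eq ?_) h
    simp only [sum_add_distrib, ← mul_sum, sum_sub_distrib, ← sum_div, sum_const, card_univ,
      nsmul_eq_mul, ← hn, sum_linkMatrix]
    ring
  have h2 := two_mul_card_pow_le_sum hW h01
  simp only [← hn, sum_add_distrib] at h2
  have hk1 := key W hW h01
  have hk2 := key W' hWs' h01'
  set a := ∑ x, ∑ y, (128 * (W x y * codegree W x y ^ 2)
        - 8 * n * codegree W x y - 16 * codegree W x y ^ 2)
  set b := ∑ x, ∑ y, (128 * (W' x y * codegree W' x y ^ 2)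
        - 8 * n * codegree W' x y - 16 * codegree W' x y ^ 2)
  have h3 : 2 * n ^ 2 ≤ a / n ^ 2 + b / n ^ 2 := by
    rw [← add_div, le_div_iff₀ (by positivity)]
    calc _ = 2 * n ^ 4 := by ring
      _ ≤ _ := h2
  have h4 : 0 ≤ (k : ℝ) / 2 * (a / n ^ 2 + b / n ^ 2 - 2 * n ^ 2) :=
    mul_nonneg (by positivity) (by linarith)
  rw [mul_add]
  linarith

end Analytic

/-! ### Homomorphism counts and averaging over colourings -/

section Counting

variable {V α : Type*} [Fintype V] [Fintype α]

/-- Path sums compute matrix powers. -/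
theorem sum_prod_path [DecidableEq α] (A : Matrix α α ℝ) (m : ℕ) (g : α → α → ℝ) :
    ∑ x : Fin (m + 1) → α, (∏ i : Fin m, A (x i.castSucc) (x i.succ)) * g (x 0) (x (Fin.last m)) =
      ∑ a, ∑ b, (A ^ m) a b * g a b := by
  induction m generalizing g with
  | zero =>
    rw [← (Equiv.funUnique (Fin 1) α).symm.sum_comp]
    simp [Matrix.one_apply]
  | succ m ih =>
    rw [← (Fin.consEquiv fun _ : Fin (m + 2) => α).sum_comp, Fintype.sum_prod_type, sum_comm]
    have h := ih fun b c => ∑ a, A a b * g a c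
    simp only [mul_sum] at h
    calc _ = _ := sum_congr rfl fun x _ => sum_congr rfl fun a _ => by
          simp only [Fin.consEquiv_apply]
          rw [Fin.prod_univ_succ]
          simp only [Fin.castSucc_zero, Fin.cons_zero, Fin.cons_succ, ← Fin.succ_castSucc,
            ← Fin.succ_last]
          rw [mul_comm (A _ _), mul_assoc]
      _ = _ := h
      _ = _ := by
        simp only [pow_succ', mul_apply, sum_mul]
        calc _ = ∑ b, ∑ a, ∑ c, (A ^ m) b c * (A a b * g a c) :=
              sum_congr rfl fun _ _ => sum_comm
          _ = ∑ a, ∑ b, ∑ c, (A ^ m) b c * (A a b * g a c) := sum_comm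
          _ = ∑ a, ∑ c, ∑ b, (A ^ m) b c * (A a b * g a c) :=
              sum_congr rfl fun _ _ => sum_comm
          _ = _ := sum_congr rfl fun _ _ => sum_congr rfl fun _ _ => sum_congr rfl fun _ _ => by
              ring

theorem sum_prod_cycle [DecidableEq α] (A : Matrix α α ℝ) (m : ℕ) :
    ∑ x : Fin (m + 1) → α, ∏ i, A (x i) (x (i + 1)) = (A ^ (m + 1)).trace := by
  have h := sum_prod_path A m fun a b => A b a
  simp only [Fin.prod_univ_castSucc, Fin.coeSucc_eq_succ, Fin.last_add_one]
  rw [h, pow_succ]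
  simp only [trace, diag_apply, mul_apply]

/-- The number of maps from the vertices of `H` that send edges of `H` to pairs related by `R`.
Unlike the adjacency of a simple graph, `R` may hold on the diagonal. -/
noncomputable def relHomCount (H : SimpleGraph V) (R : α → α → Prop) : ℕ :=
  Nat.card {f : V → α // ∀ a b, H.Adj a b → R (f a) (f b)}

omit [Fintype α] in
theorem cycleGraph_forall_adj_iff {m : ℕ} {R : α → α → Prop} (hR : ∀ a b, R a b → R b a)
    (x : Fin (m + 2) → α) :
    (∀ i j, (SimpleGraph.cycleGraph (m + 2)).Adj i j → R (x i) (x j)) ↔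
      ∀ i, R (x i) (x (i + 1)) := by
  refine ⟨fun h i => h _ _ ?_, fun h i j hij => ?_⟩
  · rw [SimpleGraph.cycleGraph_adj]; right; simp
  · rw [SimpleGraph.cycleGraph_adj] at hij
    rcases hij with hij | hij
    · rw [sub_eq_iff_eq_add'] at hij
      rw [hij, add_comm]
      simpa [add_comm] using hR _ _ (h j)
    · rw [sub_eq_iff_eq_add'] at hij
      rw [hij]
      exact h i

omit [Fintype α] in
theorem beachball_forall_adj_iff {m : ℕ} {R : α → α → Prop} (hR : ∀ a b, R a b → R b a)
    (x : Fin (m + 2) → α) (h : Bool → α) :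
    (∀ a b, (beachball (m + 2)).Adj a b → R (Sum.elim x h a) (Sum.elim x h b)) ↔
      ∀ i, (R (h true) (x i) ∧ R (h false) (x i)) ∧ R (x i) (x (i + 1)) ∧
        R (h true) (x (i + 1)) ∧ R (h false) (x (i + 1)) := by
  constructor
  · intro H i
    have H1 := fun b i => hR _ _ (H _ _ (beachball_adj_inl_inr i b))
    exact ⟨⟨H1 _ _, H1 _ _⟩, (cycleGraph_forall_adj_iff hR x).1 (fun i j hij =>
      H (.inl i) (.inl j) ((beachball_adj_inl_inl i j).2 hij)) i, H1 _ _, H1 _ _⟩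
  · intro H
    have H1 : ∀ b i, R (h b) (x i) := fun b i => by cases b <;> [exact (H i).1.2; exact (H i).1.1]
    rintro (i | a) (j | b) hab
    · exact (cycleGraph_forall_adj_iff hR x).2 (fun i => (H i).2.1) i j
        ((beachball_adj_inl_inl i j).1 hab)
    · exact hR _ _ (H1 b i)
    · exact H1 a j
    · exact absurd hab (not_beachball_adj_inr_inr a b)

/-- Fixing the two hubs, the rim is a closed walk inside their common neighbourhood. -/
theorem relHomCount_beachball [DecidableEq α] {m : ℕ} {R : α → α → Prop}
    [DecidableRel R] (hR : ∀ a b, R a b → R b a) :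
    (relHomCount (beachball (m + 2)) R : ℝ) =
      ∑ u, ∑ v, (linkMatrix (fun a b => if R a b then (1 : ℝ) else 0) u v ^ (m + 2)).trace := by
  classical
  simp only [← sum_prod_cycle]
  rw [relHomCount, Nat.card_eq_fintype_card, Fintype.card_subtype, ← sum_boole,
    ← (Equiv.sumArrowEquivProdArrow _ _ _).symm.sum_comp, Fintype.sum_prod_type,
    sum_comm, ← (Equiv.boolArrowEquivProd α).symm.sum_comp, Fintype.sum_prod_type, sum_comm]
  refine sum_congr rfl fun u _ => sum_congr rfl fun v _ => sum_congr rfl fun x _ => ?_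
  refine (if_congr (beachball_forall_adj_iff hR x
    ((Equiv.boolArrowEquivProd α).symm (v, u))) rfl rfl).trans ?_
  simp only [linkMatrix, ite_zero_mul_ite_zero, mul_one, Fintype.prod_ite_zero, prod_const_one,
    and_assoc]
  exact if_congr Iff.rfl rfl rfl

open Classical in
theorem labelledCopyCount_eq (G : SimpleGraph α) (H : SimpleGraph V) :
    G.labelledCopyCount H = #{f : V ↪ α | H.map f ≤ G} := by
  rw [SimpleGraph.labelledCopyCount, ← Fintype.card_subtype]
  refine Fintype.card_congr
    { toFun := fun c => ⟨c.toEmbedding, ?_⟩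
      invFun := fun f => ⟨⟨f.1, fun {a b} h => (SimpleGraph.map_le_iff_le_comap _ _ _).1 f.2 h⟩,
        f.1.injective⟩
      left_inv := fun c => rfl
      right_inv := fun f => rfl }
  rw [SimpleGraph.map_le_iff_le_comap]
  exact fun a b h => c.toHom.map_adj h

open Classical in
theorem relHomCount_add_descFactorial_le (G : SimpleGraph α) (H : SimpleGraph V)
    {R : α → α → Prop} (hR : ∀ a b, a ≠ b → R a b → G.Adj a b) :
    relHomCount H R + (Fintype.card α).descFactorial (Fintype.card V) ≤
      G.labelledCopyCount H + Fintype.card α ^ Fintype.card V := by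
  have h1 : #{f : V → α | Function.Injective f} =
      (Fintype.card α).descFactorial (Fintype.card V) := by
    rw [← Fintype.card_subtype, ← Fintype.card_embedding_eq]
    exact Fintype.card_congr (Equiv.subtypeInjectiveEquivEmbedding V α)
  have h2 := card_filter_add_card_filter_not (s := (univ : Finset (V → α)))
    (fun f => Function.Injective f)
  rw [card_univ, Fintype.card_fun] at h2
  have h3 : relHomCount H R ≤ G.labelledCopyCount H + #{f : V → α | ¬ Function.Injective f} := by
    rw [relHomCount, Nat.card_eq_fintype_card, Fintype.card_subtype, labelledCopyCount_eq,
      ← card_map ⟨fun f : V ↪ α => (f : V → α), DFunLike.coe_injective⟩]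
    refine le_trans (card_le_card fun f hf => ?_) (card_union_le _ _)
    simp only [mem_filter_univ, mem_union, Finset.mem_map, Function.Embedding.coeFn_mk] at hf ⊢
    by_cases hi : Function.Injective f
    · refine Or.inl ⟨⟨f, hi⟩, ?_, rfl⟩
      rw [SimpleGraph.map_le_iff_le_comap]
      exact fun a b h => hR _ _ (hi.ne h.ne) (hf a b h)
    · exact Or.inr hi
  omega

/-- A graph is the same as its part outside `K` together with its part inside `K`. -/
def supergraphProdSubgraphEquiv (K : SimpleGraph α) :
    {G // K ≤ G} × {L // L ≤ K} ≃ SimpleGraph α where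
  toFun p := (p.1.1 \ K) ⊔ p.2.1
  invFun G := (⟨G ⊔ K, le_sup_right⟩, ⟨G ⊓ K, inf_le_right⟩)
  left_inv := by
    rintro ⟨⟨G, hG⟩, ⟨L, hL⟩⟩
    refine Prod.ext (Subtype.ext ?_) (Subtype.ext ?_)
    · change (G \ K) ⊔ L ⊔ K = G
      rw [sup_assoc, sup_eq_right.2 hL, sdiff_sup_cancel hG]
    · change ((G \ K) ⊔ L) ⊓ K = L
      rw [inf_sup_right, inf_comm, inf_sdiff_self_right, bot_sup_eq, inf_eq_left.2 hL]
  right_inv G := by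
    change ((G ⊔ K) \ K) ⊔ (G ⊓ K) = G
    rw [sup_sdiff_right_self, sup_comm, sup_inf_sdiff]

/-- Subgraphs on the same vertex set correspond to sets of edges. -/
def subgraphEquivSet (K : SimpleGraph α) : {L // L ≤ K} ≃ Set K.edgeSet where
  toFun L := {e | e.1 ∈ L.1.edgeSet}
  invFun s := ⟨SimpleGraph.fromEdgeSet (Subtype.val '' s), by
    rw [← SimpleGraph.edgeSet_subset_edgeSet, SimpleGraph.edgeSet_fromEdgeSet]
    rintro e ⟨⟨e, _, rfl⟩, _⟩
    exact e.2⟩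
  left_inv := by
    rintro ⟨L, hL⟩
    refine Subtype.ext (SimpleGraph.edgeSet_injective ?_)
    ext e
    simp only [SimpleGraph.edgeSet_fromEdgeSet]
    constructor
    · rintro ⟨⟨e, he, rfl⟩, _⟩
      exact he
    · exact fun he => ⟨⟨⟨e, SimpleGraph.edgeSet_mono hL he⟩, he, rfl⟩,
        L.not_isDiag_of_mem_edgeSet he⟩
  right_inv s := by
    ext e
    simp only [SimpleGraph.edgeSet_fromEdgeSet, Set.mem_ofPred_eq]
    constructor
    · rintro ⟨⟨e', he, h⟩, _⟩
      rwa [← Subtype.ext h]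
    · exact fun he => ⟨⟨e, he, rfl⟩, K.not_isDiag_of_mem_edgeSet e.2⟩

open Classical in
/-- A fixed graph with `e` edges lies in a proportion `2 ^ (-e)` of all graphs. -/
theorem card_supergraph_mul (K : SimpleGraph α) :
    #{G : SimpleGraph α | K ≤ G} * 2 ^ Nat.card K.edgeSet = Fintype.card (SimpleGraph α) := by
  rw [← Fintype.card_congr (supergraphProdSubgraphEquiv K), Fintype.card_prod,
    Fintype.card_subtype, Fintype.card_congr (subgraphEquivSet K), Fintype.card_set,
    Nat.card_eq_fintype_card]

omit [Fintype V] [Fintype α] in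
theorem natCard_edgeSet_map (H : SimpleGraph V) (f : V ↪ α) :
    Nat.card (H.map f).edgeSet = Nat.card H.edgeSet := by
  rw [SimpleGraph.edgeSet_map]
  exact Nat.card_image_of_injective f.sym2Map.injective _

open Classical in
theorem sum_labelledCopyCount_mul (H : SimpleGraph V) :
    (∑ G : SimpleGraph α, G.labelledCopyCount H) * 2 ^ Nat.card H.edgeSet =
      (Fintype.card α).descFactorial (Fintype.card V) * Fintype.card (SimpleGraph α) := by
  simp only [labelledCopyCount_eq, card_filter]
  rw [sum_comm, sum_mul]
  simp only [← card_filter]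
  rw [sum_congr rfl fun f _ => show _ = Fintype.card (SimpleGraph α) by
    rw [← natCard_edgeSet_map H f, card_supergraph_mul]]
  rw [sum_const, card_univ, Fintype.card_embedding_eq, smul_eq_mul]

open Classical in
/-- First-moment bound: some colouring does at least as well as the average over all colourings. -/
theorem exists_labelledCopyCount_mul_le (H : SimpleGraph V) :
    ∃ G : SimpleGraph α, (G.labelledCopyCount H + Gᶜ.labelledCopyCount H) *
      2 ^ Nat.card H.edgeSet ≤ 2 * (Fintype.card α).descFactorial (Fintype.card V) := by
  have hc : ∑ G : SimpleGraph α, Gᶜ.labelledCopyCount H =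
      ∑ G : SimpleGraph α, G.labelledCopyCount H :=
    Equiv.sum_comp (Function.Involutive.toPerm _ (compl_involutive (α := SimpleGraph α)))
      fun G : SimpleGraph α => G.labelledCopyCount H
  obtain ⟨G, -, hG⟩ := exists_le_of_sum_le (s := univ)
    (f := fun G : SimpleGraph α => (G.labelledCopyCount H + Gᶜ.labelledCopyCount H) *
      2 ^ Nat.card H.edgeSet)
    (g := fun _ => 2 * (Fintype.card α).descFactorial (Fintype.card V)) univ_nonempty (by
      rw [← sum_mul, sum_add_distrib, hc, add_mul, sum_labelledCopyCount_mul, sum_const, card_univ,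
        smul_eq_mul]
      exact le_of_eq (by ring))
  exact ⟨G, hG⟩

theorem ramseyMultiplicity_mul_le (H : SimpleGraph V) (n : ℕ) :
    ramseyMultiplicity H n * 2 ^ Nat.card H.edgeSet ≤ 2 * n.descFactorial (Fintype.card V) := by
  obtain ⟨G, hG⟩ := exists_labelledCopyCount_mul_le (α := Fin n) H
  rw [Fintype.card_fin] at hG
  exact (Nat.mul_le_mul_right _ (Nat.sInf_le (Set.mem_range_self G))).trans hG

theorem card_edgeSet_beachball (m : ℕ) : Nat.card (beachball (m + 3)).edgeSet = 3 * (m + 3) := by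
  classical
  have h := (beachball (m + 3)).two_mul_card_edgeFinset
  have hc : ∀ i, ∑ j, (if (SimpleGraph.cycleGraph (m + 3)).Adj i j then 1 else 0) = 2 := fun i => by
    rw [← card_filter, ← SimpleGraph.neighborFinset_eq_filter,
      SimpleGraph.card_neighborFinset_eq_degree,
      SimpleGraph.cycleGraph_degree_three_le]
  have hs : ∀ (i : Fin (m + 3)) b, (beachball (m + 3)).Adj (.inr b) (.inl i) := fun i b =>
    (beachball_adj_inl_inr i b).symm
  rw [card_filter, ← univ_product_univ, sum_product] at h
  simp only [Fintype.sum_sum_type, beachball_adj_inl_inl, beachball_adj_inl_inr, hs,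
    not_beachball_adj_inr_inr, if_true, if_false, sum_add_distrib, hc, sum_const, card_univ,
    Fintype.card_fin, Fintype.card_bool, smul_eq_mul] at h
  rw [Nat.card_eq_fintype_card, ← SimpleGraph.edgeFinset_card]
  omega

end Counting

/-! ### The limit -/

section Limit

/-- In every 2-colouring, the homomorphism counts of the beachball into the two colour classes, one
of which includes the loops, add up to at least their value in a random colouring. -/
theorem two_mul_card_pow_le_relHomCount_add {α : Type*} [Fintype α] [Nonempty α]
    (G : SimpleGraph α) {k : ℕ} (hk : 2 ≤ k) :
    2 * (Fintype.card α : ℝ) ^ (2 * k + 2) ≤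
      8 ^ (2 * k) * ((relHomCount (beachball (2 * k)) G.Adj : ℝ) +
        relHomCount (beachball (2 * k)) (fun a b => ¬ G.Adj a b)) := by
  classical
  set W : Matrix α α ℝ := fun a b => if G.Adj a b then 1 else 0 with hW
  have hWs : W.IsSymm := by
    ext a b
    change (if G.Adj b a then (1 : ℝ) else 0) = if G.Adj a b then 1 else 0
    rw [if_congr (G.adj_comm b a) rfl rfl]
  have h01 : ∀ a b, W a b = 0 ∨ W a b = 1 := fun a b => by
    by_cases h : G.Adj a b <;> simp [hW, h]
  have hW' : (fun a b => 1 - W a b : Matrix α α ℝ) = fun a b => if ¬ G.Adj a b then 1 else 0 := by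
    funext a b
    by_cases h : G.Adj a b <;> simp [hW, h]
  have h := le_sum_trace_linkMatrix hWs h01 hk
  obtain ⟨m, hm⟩ : ∃ m, 2 * k = m + 2 := ⟨2 * k - 2, by omega⟩
  rw [hW'] at h
  have hn0 : (0 : ℝ) < Fintype.card α := by exact_mod_cast Fintype.card_pos
  rw [hm] at h ⊢
  rw [relHomCount_beachball fun a b h => h.symm,
    relHomCount_beachball fun a b h h' => h h'.symm]
  rw [div_pow, div_mul_eq_mul_div, le_div_iff₀ (by positivity)] at h
  calc _ = 2 * (Fintype.card α : ℝ) ^ 2 * (Fintype.card α : ℝ) ^ (m + 2) := by ring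
    _ ≤ _ := h

/-- A homomorphism into a colour class that is injective is a labelled copy, so the bound for
homomorphisms passes to labelled copies up to the number of non-injective maps, once per colour. -/
theorem le_ramseyMultiplicity_beachball {k n : ℕ} (hk : 2 ≤ k) (hn : 0 < n) :
    (2 * (8⁻¹ : ℝ) ^ (2 * k) - 2) * (n : ℝ) ^ (2 * k + 2) + 2 * n.descFactorial (2 * k + 2) ≤
      ramseyMultiplicity (beachball (2 * k)) n := by
  have : Nonempty (Fin n) := ⟨⟨0, hn⟩⟩
  obtain ⟨G, hG⟩ : ∃ G : SimpleGraph (Fin n), _ = ramseyMultiplicity (beachball (2 * k)) n :=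
    Nat.sInf_mem (Set.range_nonempty _)
  have h := two_mul_card_pow_le_relHomCount_add G hk
  have h1 := relHomCount_add_descFactorial_le G (beachball (2 * k)) (R := G.Adj) fun _ _ _ h => h
  have h2 := relHomCount_add_descFactorial_le Gᶜ (beachball (2 * k)) (R := fun a b => ¬ G.Adj a b)
    fun _ _ hne h => ⟨hne, h⟩
  simp only [Fintype.card_sum, Fintype.card_fin, Fintype.card_bool] at h h1 h2
  rw [← div_le_iff₀' (by positivity)] at h
  have h1' : (relHomCount (beachball (2 * k)) G.Adj : ℝ) + n.descFactorial (2 * k + 2) ≤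
    G.labelledCopyCount (beachball (2 * k)) + (n : ℝ) ^ (2 * k + 2) := by exact_mod_cast h1
  have h2' : (relHomCount (beachball (2 * k)) (fun a b => ¬ G.Adj a b) : ℝ) +
      n.descFactorial (2 * k + 2) ≤
    Gᶜ.labelledCopyCount (beachball (2 * k)) + (n : ℝ) ^ (2 * k + 2) := by exact_mod_cast h2
  rw [← hG]
  push_cast
  have e : 2 * (n : ℝ) ^ (2 * k + 2) / 8 ^ (2 * k) =
      2 * (8⁻¹ : ℝ) ^ (2 * k) * (n : ℝ) ^ (2 * k + 2) := by
    rw [inv_pow]; ring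
  rw [e] at h
  linarith

end Limit

end CommonGraph

theorem theorem4p3 (k : ℕ) (hk : 2 ≤ k) : CommonGraph.IsCommon (CommonGraph.beachball (2 * k)) := by
  have he : Nat.card (CommonGraph.beachball (2 * k)).edgeSet = 3 * (2 * k) := by
    obtain ⟨m, hm⟩ : ∃ m, 2 * k = m + 3 := ⟨2 * k - 3, by omega⟩
    rw [hm, CommonGraph.card_edgeSet_beachball]
  have hc : (2 : ℝ) ^ (1 - (Nat.card (CommonGraph.beachball (2 * k)).edgeSet : ℤ)) =
      2 * (8⁻¹ : ℝ) ^ (2 * k) := by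
    rw [he, zpow_sub₀ two_ne_zero, zpow_one, zpow_natCast, pow_mul, inv_pow, div_eq_mul_inv]
    norm_num
  have hv : Fintype.card (Fin (2 * k) ⊕ Bool) = 2 * k + 2 := by simp
  rw [CommonGraph.IsCommon, CommonGraph.HasRamseyMultiplicityConstant, hc, hv]
  -- Non-injective maps are a vanishing proportion of all maps.
  have hratio : Tendsto (fun n : ℕ => (n : ℝ) ^ (2 * k + 2) / (n.descFactorial (2 * k + 2) : ℝ))
      atTop (𝓝 1) := by
    have h := (isEquivalent_descFactorial (2 * k + 2)).symm
    refine (Asymptotics.isEquivalent_iff_tendsto_one ?_).1 h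
    filter_upwards [eventually_ge_atTop (2 * k + 2)] with n hn
    exact_mod_cast (Nat.descFactorial_pos.2 hn).ne'
  have hlow := (hratio.const_mul (2 * (8⁻¹ : ℝ) ^ (2 * k) - 2)).add_const 2
  rw [mul_one, sub_add_cancel] at hlow
  refine tendsto_of_tendsto_of_tendsto_of_le_of_le' hlow tendsto_const_nhds ?_ ?_
  · filter_upwards [eventually_ge_atTop (2 * k + 2)] with n hn
    have hd : (0 : ℝ) < n.descFactorial (2 * k + 2) := by
      exact_mod_cast Nat.descFactorial_pos.2 hn
    rw [le_div_iff₀ hd, add_mul, mul_assoc, div_mul_cancel₀ _ hd.ne']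
    exact CommonGraph.le_ramseyMultiplicity_beachball hk (by omega)
  · filter_upwards [eventually_ge_atTop (2 * k + 2)] with n hn
    have hd : (0 : ℝ) < n.descFactorial (2 * k + 2) := by
      exact_mod_cast Nat.descFactorial_pos.2 hn
    have h := CommonGraph.ramseyMultiplicity_mul_le (CommonGraph.beachball (2 * k)) n
    rw [he, hv, pow_mul] at h
    have h' : (CommonGraph.ramseyMultiplicity (CommonGraph.beachball (2 * k)) n : ℝ) * 8 ^ (2 * k) ≤
        2 * n.descFactorial (2 * k + 2) := by exact_mod_cast h
    rw [div_le_iff₀ hd, inv_pow, mul_right_comm, ← div_eq_mul_inv, le_div_iff₀ (by positivity)]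
    exact h'
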